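/- Let $\Omega$ be the open unit ball of $\mathbb R^3$, $\mathbf r$ the position vector, and for a vector field $\mathbf u$ call $(P_{\mathbf u},T_{\mathbf u})$ with $P_{\mathbf u}\in C^2(\overline\Omega)$, $T_{\mathbf u}\in C^1(\overline\Omega)$ a pair of poloidal and toroidal scalars of $\mathbf u$ if $\mathbf u=\nabla\times\nabla\times(\mathbf rP_{\mathbf u})+\nabla\times(\mathbf rT_{\mathbf u})$ in $\Omega$. With the azimuth $\lambda$, the polar angle $\theta$ and the unit vectors $\hat\lambda,\hat\theta$, let \[\nabla_1 f=\frac1{\sin\theta}\frac{\partial f}{\partial\lambda}\hat\lambda+\frac{\partial f}{\partial\theta}\hat\theta,\qquad \Lambda_1 g=-\frac{\partial g}{\partial\theta}\hat\lambda+\frac1{\sin\theta}\frac{\partial g}{\partial\lambda}\hat\theta\] be the surface gradient and surface curl on the unit sphere $\partial\Omega$. Let $\mathbf v\in C^1(\overline\Omega;\mathbb R^3)$ have the tangential boundary values $\mathbf v|_{\partial\Omega}=\nabla_1f+\Lambda_1g$ (away from the poles), where $f,g\in C^2(\partial\Omega)$, and let $\boldsymbol\omega=\nabla\times\mathbf v$.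 Then: 1. For every pair $(P_{\boldsymbol\omega},T_{\boldsymbol\omega})$ of poloidal and toroidal scalars of $\boldsymbol\omega$, $P_{\boldsymbol\omega}|_{\partial\Omega}=g$ up to the additive constant that is free in $P_{\boldsymbol\omega}$: there is a constant $c$ such that $(P_{\boldsymbol\omega}-c,T_{\boldsymbol\omega})$ is again such a pair and $(P_{\boldsymbol\omega}-c)|_{\partial\Omega}=g$. If $P_{\boldsymbol\omega}|_{\partial\Omega}$ and $g$ have the same mean value over $\partial\Omega$, then $P_{\boldsymbol\omega}|_{\partial\Omega}=g$. 2. Let $(P_{\mathbf v},T_{\mathbf v})$ be a pair of poloidal and toroidal scalars of $\mathbf v$ with $P_{\mathbf v}\in C^3(\overline\Omega)$ and $T_{\mathbf v}\in C^2(\overline\Omega)$. Then $T_{\mathbf v}$ is a poloidal scalar of $\boldsymbol\omega$, with toroidal partner $-\nabla^2P_{\mathbf v}$. For every pair $(P_{\boldsymbol\omega},T_{\boldsymbol\omega})$ as in 1, $T_{\mathbf v}=P_{\boldsymbol\omega}$ on $\overline\Omega$ up to the addition of a function of $r$, and exactly if both have the same mean over each sphere $|x|=r$, $0\le r\le1$.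 Finally, $T_{\mathbf v}(1,\cdot)=g$ up to an additive constant, and exactly if both sides have the same mean over $\partial\Omega$. -/

import Mathlib

open scoped Manifold ContDiff

noncomputable section

/-- Euclidean three-space. -/
abbrev E3 : Type := EuclideanSpace ℝ (Fin 3)

/-- The unit sphere, i.e. the boundary of the unit ball of `E3`. -/
abbrev S2 : Type := Metric.sphere (0 : E3) 1

instance instFactFinrankE3 : Fact (Module.finrank ℝ E3 = 2 + 1) :=
  ⟨finrank_euclideanSpace_fin⟩

/-- The partial derivative `∂ᵢ uⱼ` at `x`. -/
def pderivComp (u : E3 → E3) (i j : Fin 3) (x : E3) : ℝ :=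
  fderiv ℝ u x (EuclideanSpace.single i 1) j

/-- The curl of a vector field on three-space, in Cartesian coordinates. -/
def curl (u : E3 → E3) (x : E3) : E3 :=
  !₂[pderivComp u 1 2 x - pderivComp u 2 1 x,
     pderivComp u 2 0 x - pderivComp u 0 2 x,
     pderivComp u 0 1 x - pderivComp u 1 0 x]

/-- `(P, T)` are a poloidal scalar and a toroidal scalar of the vector field `u` on the unit ball:
`u = ∇ × ∇ × (𝐫 P) + ∇ × (𝐫 T)`, where `𝐫` is the position vector. The scalars are of class `C²`
and `C¹` up to the boundary, as many derivatives as the formula takes. -/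
structure IsPTScalars (u : E3 → E3) (P T : E3 → ℝ) : Prop where
  contDiffOn_poloidal : ContDiffOn ℝ 2 P (Metric.closedBall 0 1)
  contDiffOn_toroidal : ContDiffOn ℝ 1 T (Metric.closedBall 0 1)
  eq_add : ∀ x ∈ Metric.ball (0 : E3) 1,
    u x = curl (curl fun y => P y • y) x + curl (fun y => T y • y) x

/-- The point of the unit sphere with azimuth `lam` and polar angle `θ`. -/
def spherePoint (lam θ : ℝ) : S2 :=
  ⟨!₂[Real.sin θ * Real.cos lam, Real.sin θ * Real.sin lam, Real.cos θ], by
    rw [mem_sphere_zero_iff_norm, EuclideanSpace.norm_eq, Real.sqrt_eq_one, Fin.sum_univ_three]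
    simp only [Real.norm_eq_abs, sq_abs, Matrix.cons_val_zero,
      Matrix.cons_val_one, Matrix.cons_val]
    nlinarith [Real.sin_sq_add_cos_sq θ, Real.sin_sq_add_cos_sq lam]⟩

/-- The azimuthal unit vector. -/
def azimuthHat (lam : ℝ) : E3 := !₂[-Real.sin lam, Real.cos lam, 0]

/-- The polar unit vector. -/
def polarHat (lam θ : ℝ) : E3 :=
  !₂[Real.cos θ * Real.cos lam, Real.cos θ * Real.sin lam, -Real.sin θ]

/-- `∂f/∂λ` for a function on the unit sphere. -/
def dAzimuth (f : S2 → ℝ) (lam θ : ℝ) : ℝ := deriv (fun s => f (spherePoint s θ)) lam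

/-- `∂f/∂θ` for a function on the unit sphere. -/
def dPolar (f : S2 → ℝ) (lam θ : ℝ) : ℝ := deriv (fun s => f (spherePoint lam s)) θ

/-- The surface gradient `∇₁ f` in spherical coordinates (meaningful for `0 < θ < π`). -/
def surfaceGrad (f : S2 → ℝ) (lam θ : ℝ) : E3 :=
  (1 / Real.sin θ * dAzimuth f lam θ) • azimuthHat lam + dPolar f lam θ • polarHat lam θ

/-- The surface curl `Λ₁ g` in spherical coordinates (meaningful for `0 < θ < π`). -/
def surfaceCurl (g : S2 → ℝ) (lam θ : ℝ) : E3 :=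
  (-dPolar g lam θ) • azimuthHat lam + (1 / Real.sin θ * dAzimuth g lam θ) • polarHat lam θ

/-- The average of a function over the unit sphere with respect to surface area. -/
def sphereMean (h : S2 → ℝ) : ℝ :=
  ⨍ ξ, h ξ ∂((MeasureTheory.volume : MeasureTheory.Measure E3).toSphere)

end

/-!
The proof replaces the equation `Δ₁ (P_ω - g) = 0` on the sphere by a first-order system, so that no
second derivatives on the sphere and no regularity theory are needed.

If `(P, T)` are scalars of `∇ × v`, then `v - ∇P × 𝐫 - 𝐫 T` is curl-free, because
`∇ × (𝐫 P) = ∇P × 𝐫`. It is of class `C¹` up to the boundary, so the Poincaré lemma on the closed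
ball gives `v = ∇φ + ∇P × 𝐫 + 𝐫 T` there (`IsPTScalars.exists_potential`). On the unit sphere the
tangential part of this identity reads `∇₁ f + Λ₁ g = ∇₁ φ + Λ₁ P`, that is,
`∇₁ (f - φ) = Λ₁ (P - g)`. These are the Cauchy-Riemann equations: in the Mercator coordinate
`s + i λ` with `θ = 2 arctan (exp s)`, the function `(f - φ) + i (P - g)` is entire, and it is
bounded, so it is constant by Liouville's theorem (`exists_const_of_cauchyRiemann`). This is the
statement on boundary values, `IsPTScalars.exists_sub_eq_const_of_boundary`.

The difference `Q` of two poloidal scalars of one field is a poloidal scalar of the zero field. The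
same argument with `v = 0`, on the sphere of radius `ρ`, gives `∇₁ φ = -ρ Λ₁ Q`, so `Q` is a function
of the radius (`IsPTScalars.exists_eq_const_of_zero`).

Finally `∇ × ∇ × (𝐫 P) = ∇(P + 𝐫 · ∇P) - 𝐫 ∇²P` yields `∇ × ∇ × ∇ × (𝐫 P) = ∇ × (-𝐫 ∇²P)`, so the
scalars of the vorticity can be taken to be `T_v` and `-∇²P_v` (`IsPTScalars.curl`), and everything
said about `P_ω` applies to `T_v`. In each case the free constant vanishes when the means agree.
-/

noncomputable section

/-! ### Liouville's theorem on the sphere -/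

/-- `θ = 2 arctan (exp s)` solves `dθ/ds = sin θ`, which makes `s + i λ` a conformal coordinate. -/
lemma hasDerivAt_two_mul_arctan_exp (s : ℝ) :
    HasDerivAt (fun s => 2 * Real.arctan (Real.exp s))
      (Real.sin (2 * Real.arctan (Real.exp s))) s := by
  have h := ((Real.hasDerivAt_exp s).arctan).const_mul 2
  refine h.congr_deriv ?_
  rw [Real.sin_two_mul, Real.sin_arctan, Real.cos_arctan]
  have h1 : 0 < 1 + Real.exp s ^ 2 := by positivity
  have h2 : √(1 + Real.exp s ^ 2) ^ 2 = 1 + Real.exp s ^ 2 := Real.sq_sqrt h1.le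
  have h3 : √(1 + Real.exp s ^ 2) ≠ 0 := (Real.sqrt_pos.2 h1).ne'
  field_simp
  rw [h2]

lemma two_mul_arctan_exp_mem_Ioo (s : ℝ) :
    2 * Real.arctan (Real.exp s) ∈ Set.Ioo 0 Real.pi := by
  have h1 := Real.arctan_pos.2 (Real.exp_pos s)
  have h2 := Real.arctan_lt_pi_div_two (Real.exp s)
  constructor <;> linarith

lemma exists_two_mul_arctan_exp_eq {θ : ℝ} (hθ : θ ∈ Set.Ioo 0 Real.pi) :
    ∃ s, 2 * Real.arctan (Real.exp s) = θ := by
  obtain ⟨h0, h1⟩ := hθ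
  refine ⟨Real.log (Real.tan (θ / 2)), ?_⟩
  rw [Real.exp_log (Real.tan_pos_of_pos_of_lt_pi_div_two (by linarith) (by linarith)),
    Real.arctan_tan (by linarith) (by linarith)]
  ring

lemma contDiff_spherePoint {n : WithTop ℕ∞} :
    ContDiff ℝ n (fun p : ℝ × ℝ => (spherePoint p.1 p.2 : E3)) := by
  rw [contDiff_euclidean]
  intro i
  fin_cases i <;> simp [spherePoint] <;> fun_prop

lemma continuous_spherePoint : Continuous fun p : ℝ × ℝ => spherePoint p.1 p.2 :=
  continuous_induced_rng.2 (contDiff_spherePoint (n := 0)).continuous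

/-- Longitude and colatitude of a point: the argument of `x + i y` and `arccos z`. -/
lemma exists_eq_spherePoint (ξ : S2) : ∃ lam, ∃ θ ∈ Set.Icc 0 Real.pi, ξ = spherePoint lam θ := by
  have hξ : (ξ : E3) 0 ^ 2 + (ξ : E3) 1 ^ 2 + (ξ : E3) 2 ^ 2 = 1 := by
    have h := mem_sphere_zero_iff_norm.1 ξ.2
    rw [EuclideanSpace.norm_eq, Real.sqrt_eq_one, Fin.sum_univ_three] at h
    simpa using h
  set z : ℂ := ⟨(ξ : E3) 0, (ξ : E3) 1⟩ with hz
  refine ⟨z.arg, Real.arccos ((ξ : E3) 2), ⟨Real.arccos_nonneg _, Real.arccos_le_pi _⟩, ?_⟩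
  have hs : Real.sin (Real.arccos ((ξ : E3) 2)) = ‖z‖ := by
    rw [Real.sin_arccos, Complex.norm_def, Complex.normSq_apply]
    congr 1
    simp only [hz]
    linarith
  have hc : Real.cos (Real.arccos ((ξ : E3) 2)) = (ξ : E3) 2 :=
    Real.cos_arccos (by nlinarith) (by nlinarith)
  apply Subtype.ext
  ext i
  fin_cases i
  · simp [spherePoint, hs, Complex.norm_mul_cos_arg, hz]
  · simp [spherePoint, hs, Complex.norm_mul_sin_arg, hz]
  · simp [spherePoint, hc]

lemma continuous_spherePoint_polar (lam : ℝ) : Continuous fun θ => spherePoint lam θ :=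
  Continuous.comp (g := fun p : ℝ × ℝ => spherePoint p.1 p.2) (f := fun θ => (lam, θ))
    continuous_spherePoint (Continuous.prodMk_right lam)

lemma eq_const_on_meridian {b : S2 → ℝ} {c : ℝ} (hb : Continuous b) (lam : ℝ)
    (h : ∀ θ ∈ Set.Ioo 0 Real.pi, b (spherePoint lam θ) = c) :
    Set.Icc 0 Real.pi ⊆ {θ | b (spherePoint lam θ) = c} := by
  rw [← closure_Ioo Real.pi_pos.ne]
  exact closure_minimal h
    (isClosed_eq (hb.comp (continuous_spherePoint_polar lam)) continuous_const)

/-- A continuous function on the sphere which takes a single value off the two poles takes it there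
too. -/
lemma eq_const_of_forall_Ioo {b : S2 → ℝ} {c : ℝ} (hb : Continuous b)
    (h : ∀ lam, ∀ θ ∈ Set.Ioo 0 Real.pi, b (spherePoint lam θ) = c) (ξ : S2) : b ξ = c := by
  obtain ⟨lam, θ, hθ, hξ⟩ := exists_eq_spherePoint ξ
  rw [hξ]
  exact eq_const_on_meridian hb lam (h lam) hθ

/-- Liouville's theorem on the sphere: continuous solutions of the Cauchy-Riemann equations
`∇₁ a = Λ₁ b` are constant. In the conformal (Mercator) coordinate `s + i λ`, where
`θ = 2 arctan (exp s)`, the function `a + i b` is entire, and it is bounded since the sphere is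
compact. -/
theorem exists_const_of_cauchyRiemann {a b : S2 → ℝ} (ha : Continuous a) (hb : Continuous b)
    (ha' : Differentiable ℝ fun p : ℝ × ℝ => a (spherePoint p.1 p.2))
    (hb' : Differentiable ℝ fun p : ℝ × ℝ => b (spherePoint p.1 p.2))
    (h₁ : ∀ lam, ∀ θ ∈ Set.Ioo 0 Real.pi, dAzimuth a lam θ = -(Real.sin θ * dPolar b lam θ))
    (h₂ : ∀ lam, ∀ θ ∈ Set.Ioo 0 Real.pi, dAzimuth b lam θ = Real.sin θ * dPolar a lam θ) :
    ∃ c, ∀ ξ, b ξ = c := by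
  set τ : ℝ → ℝ := fun s => 2 * Real.arctan (Real.exp s) with hτ
  -- derivative of a function on the sphere in the coordinate `s + i λ`, using `dθ/ds = sin θ`
  have key : ∀ u : S2 → ℝ, Differentiable ℝ (fun p : ℝ × ℝ => u (spherePoint p.1 p.2)) →
      ∀ z : ℂ, HasFDerivAt (fun z : ℂ => u (spherePoint z.im (τ z.re)))
        (dAzimuth u z.im (τ z.re) • Complex.imCLM +
          (Real.sin (τ z.re) * dPolar u z.im (τ z.re)) • Complex.reCLM) z := by
    intro u hu z
    have hU := (hu (z.im, τ z.re)).hasFDerivAt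
    have hτ' : HasFDerivAt (fun z : ℂ => τ z.re) (Real.sin (τ z.re) • Complex.reCLM) z :=
      (hasDerivAt_two_mul_arctan_exp z.re).comp_hasFDerivAt z Complex.reCLM.hasFDerivAt
    have hc := HasFDerivAt.comp z (f := fun z : ℂ => (z.im, τ z.re)) hU
      (Complex.imCLM.hasFDerivAt.prodMk hτ')
    refine hc.congr_fderiv ?_
    have hA : dAzimuth u z.im (τ z.re)
        = fderiv ℝ (fun p : ℝ × ℝ => u (spherePoint p.1 p.2)) (z.im, τ z.re) (1, 0) :=
      (HasFDerivAt.comp_hasDerivAt (f := fun s : ℝ => (s, τ z.re)) z.im hU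
        ((hasDerivAt_id z.im).prodMk (hasDerivAt_const z.im (τ z.re)))).deriv
    have hP : dPolar u z.im (τ z.re)
        = fderiv ℝ (fun p : ℝ × ℝ => u (spherePoint p.1 p.2)) (z.im, τ z.re) (0, 1) :=
      (HasFDerivAt.comp_hasDerivAt (f := fun s : ℝ => (z.im, s)) (τ z.re) hU
        ((hasDerivAt_const (τ z.re) z.im).prodMk (hasDerivAt_id (τ z.re)))).deriv
    ext w
    rw [hA, hP]
    have : ((w.im, Real.sin (τ z.re) * w.re) : ℝ × ℝ)
        = w.im • ((1 : ℝ), (0 : ℝ)) + (Real.sin (τ z.re) * w.re) • ((0 : ℝ), (1 : ℝ)) := by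
      ext <;> simp
    simp only [ContinuousLinearMap.comp_apply, ContinuousLinearMap.prod_apply,
      smul_apply, add_apply, Complex.imCLM_apply,
      Complex.reCLM_apply, smul_eq_mul, this, map_add, map_smul]
    ring
  set F : ℂ → ℂ := fun z =>
    (a (spherePoint z.im (τ z.re)) : ℂ) + b (spherePoint z.im (τ z.re)) * Complex.I with hF
  have hFd : Differentiable ℂ F := by
    intro z
    have h := ((Complex.ofRealCLM.hasFDerivAt).comp z (key a ha' z)).add
      (((Complex.ofRealCLM.hasFDerivAt).comp z (key b hb' z)).mul_const Complex.I)
    have h' : HasFDerivAt F _ z := h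
    rw [differentiableAt_complex_iff_differentiableAt_real]
    refine ⟨h'.differentiableAt, ?_⟩
    rw [h'.fderiv]
    have e1 := h₁ z.im (τ z.re) (two_mul_arctan_exp_mem_Ioo _)
    have e2 := h₂ z.im (τ z.re) (two_mul_arctan_exp_mem_Ioo _)
    apply Complex.ext <;> simp [e1, e2]
  have hFb : Bornology.IsBounded (Set.range F) := by
    have hc : Continuous fun ξ : S2 => (a ξ : ℂ) + b ξ * Complex.I := by fun_prop
    refine (isCompact_range hc).isBounded.subset ?_
    rintro _ ⟨z, rfl⟩
    exact ⟨spherePoint z.im (τ z.re), rfl⟩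
  refine ⟨(F 0).im, eq_const_of_forall_Ioo hb fun lam θ hθ => ?_⟩
  obtain ⟨s, rfl⟩ := exists_two_mul_arctan_exp_eq hθ
  rw [← hFd.apply_eq_apply_of_bounded hFb ⟨s, lam⟩ 0]
  simp [hF, hτ]

/-! ### Partial derivatives and the curl -/

/-- The partial derivative `∂ᵢ f` at `x` of a scalar function. -/
def pderiv (i : Fin 3) (f : E3 → ℝ) (x : E3) : ℝ := fderiv ℝ f x (EuclideanSpace.single i 1)

lemma pderivComp_eq {u : E3 → E3} {x : E3} (hu : DifferentiableAt ℝ u x) (i j : Fin 3) :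
    pderivComp u i j x = pderiv i (fun y => u y j) x := by
  have h : HasFDerivAt (fun y => u y j) ((EuclideanSpace.proj j).comp (fderiv ℝ u x)) x :=
    (EuclideanSpace.proj (𝕜 := ℝ) j : E3 →L[ℝ] ℝ).hasFDerivAt.comp x hu.hasFDerivAt
  rw [pderiv, h.fderiv]
  rfl

lemma pderiv_add {f g : E3 → ℝ} {x : E3} (hf : DifferentiableAt ℝ f x)
    (hg : DifferentiableAt ℝ g x) (i : Fin 3) :
    pderiv i (fun y => f y + g y) x = pderiv i f x + pderiv i g x := by
  simp [pderiv, fderiv_fun_add hf hg]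

lemma pderiv_sub {f g : E3 → ℝ} {x : E3} (hf : DifferentiableAt ℝ f x)
    (hg : DifferentiableAt ℝ g x) (i : Fin 3) :
    pderiv i (fun y => f y - g y) x = pderiv i f x - pderiv i g x := by
  simp [pderiv, fderiv_fun_sub hf hg]

lemma pderiv_mul_coord {f : E3 → ℝ} {x : E3} (hf : DifferentiableAt ℝ f x) (i j : Fin 3) :
    pderiv i (fun y => f y * y j) x = pderiv i f x * x j + if j = i then f x else 0 := by
  have h : HasFDerivAt (fun y : E3 => y j) (EuclideanSpace.proj (𝕜 := ℝ) j) x :=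
    (EuclideanSpace.proj (𝕜 := ℝ) j : E3 →L[ℝ] ℝ).hasFDerivAt
  have h' : HasFDerivAt (fun y => f y * y j) _ x := hf.hasFDerivAt.mul h
  rw [pderiv, h'.fderiv]
  simp only [add_apply, smul_apply, smul_eq_mul, PiLp.proj_apply, PiLp.single_apply, pderiv]
  split_ifs <;> ring

lemma ContDiffAt.pderiv {m n : WithTop ℕ∞} {f : E3 → ℝ} {x : E3} (hf : ContDiffAt ℝ n f x)
    (hmn : m + 1 ≤ n) (i : Fin 3) : ContDiffAt ℝ m (pderiv i f) x :=
  (hf.fderiv_right hmn).clm_apply contDiffAt_const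

lemma pderiv_comm {f : E3 → ℝ} {x : E3} (hf : ContDiffAt ℝ 2 f x) (i j : Fin 3) :
    pderiv i (pderiv j f) x = pderiv j (pderiv i f) x := by
  have hd : DifferentiableAt ℝ (fderiv ℝ f) x :=
    (hf.fderiv_right (m := 1) (by norm_num)).differentiableAt (by norm_num)
  have key : ∀ i j, pderiv i (pderiv j f) x
      = fderiv ℝ (fderiv ℝ f) x (EuclideanSpace.single i 1) (EuclideanSpace.single j 1) := by
    intro i j
    have h : HasFDerivAt (pderiv j f) _ x :=
      hd.hasFDerivAt.clm_apply (hasFDerivAt_const (EuclideanSpace.single j (1 : ℝ)) x)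
    rw [pderiv, h.fderiv]
    simp
  rw [key, key]
  exact (hf.isSymmSndFDerivAt (by simp)) _ _

lemma Filter.EventuallyEq.pderiv {f g : E3 → ℝ} {x : E3} (h : f =ᶠ[nhds x] g) (i : Fin 3) :
    pderiv i f x = pderiv i g x := by
  rw [_root_.pderiv, h.fderiv_eq, _root_.pderiv]

lemma laplacian_eq_sum_pderiv {f : E3 → ℝ} {x : E3} (hf : ContDiffAt ℝ 2 f x) :
    Laplacian.laplacian f x = ∑ i, pderiv i (pderiv i f) x := by
  have hd : DifferentiableAt ℝ (fderiv ℝ f) x :=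
    (hf.fderiv_right (m := 1) (by norm_num)).differentiableAt (by norm_num)
  rw [InnerProductSpace.laplacian_eq_iteratedFDeriv_orthonormalBasis f
    (EuclideanSpace.basisFun (Fin 3) ℝ)]
  refine Finset.sum_congr rfl fun i _ => ?_
  have h : HasFDerivAt (pderiv i f) _ x :=
    hd.hasFDerivAt.clm_apply (hasFDerivAt_const (EuclideanSpace.single i (1 : ℝ)) x)
  rw [iteratedFDeriv_two_apply, pderiv, h.fderiv]
  simp

lemma Filter.EventuallyEq.curl {u w : E3 → E3} {x : E3} (h : u =ᶠ[nhds x] w) :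
    curl u x = curl w x := by
  simp only [_root_.curl, pderivComp, h.fderiv_eq]

lemma curl_add {u w : E3 → E3} {x : E3} (hu : DifferentiableAt ℝ u x)
    (hw : DifferentiableAt ℝ w x) : curl (fun y => u y + w y) x = curl u x + curl w x := by
  ext i
  fin_cases i <;> simp [curl, pderivComp, fderiv_fun_add hu hw] <;> ring

lemma curl_sub {u w : E3 → E3} {x : E3} (hu : DifferentiableAt ℝ u x)
    (hw : DifferentiableAt ℝ w x) : curl (fun y => u y - w y) x = curl u x - curl w x := by
  ext i
  fin_cases i <;> simp [curl, pderivComp, fderiv_fun_sub hu hw] <;> ring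

lemma curl_zero : curl (fun _ => 0) = fun _ => 0 := by
  ext x i
  fin_cases i <;> simp [curl, pderivComp]

/-- `∇ × (𝐫 P) = ∇P × 𝐫`. -/
lemma curl_smul_id {P : E3 → ℝ} {x : E3} (hP : DifferentiableAt ℝ P x) :
    curl (fun y => P y • y) x =
      !₂[pderiv 1 P x * x 2 - pderiv 2 P x * x 1,
         pderiv 2 P x * x 0 - pderiv 0 P x * x 2,
         pderiv 0 P x * x 1 - pderiv 1 P x * x 0] := by
  have h : DifferentiableAt ℝ (fun y => P y • y) x := hP.smul differentiableAt_id
  ext i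
  fin_cases i <;> simp [curl, pderivComp_eq h, pderiv_mul_coord hP]

lemma contDiffAt_euclidean_three {n : WithTop ℕ∞} {a b c : E3 → ℝ} {x : E3}
    (ha : ContDiffAt ℝ n a x) (hb : ContDiffAt ℝ n b x) (hc : ContDiffAt ℝ n c x) :
    ContDiffAt ℝ n (fun y => (!₂[a y, b y, c y] : E3)) x := by
  rw [contDiffAt_euclidean]
  intro i
  fin_cases i <;> simpa

lemma ContDiffAt.curl {m n : WithTop ℕ∞} {u : E3 → E3} {x : E3} (hu : ContDiffAt ℝ n u x)
    (hmn : m + 1 ≤ n) : ContDiffAt ℝ m (curl u) x := by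
  have hp : ∀ i j, ContDiffAt ℝ m (pderivComp u i j) x := fun i j =>
    contDiffAt_euclidean.1 ((hu.fderiv_right hmn).clm_apply contDiffAt_const) j
  exact contDiffAt_euclidean_three ((hp 1 2).sub (hp 2 1)) ((hp 2 0).sub (hp 0 2))
    ((hp 0 1).sub (hp 1 0))

lemma eventually_curl_smul_id {P : E3 → ℝ} {x : E3} (hP : ContDiffAt ℝ 1 P x) :
    curl (fun y => P y • y) =ᶠ[nhds x] fun y =>
      !₂[pderiv 1 P y * y 2 - pderiv 2 P y * y 1,
         pderiv 2 P y * y 0 - pderiv 0 P y * y 2,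
         pderiv 0 P y * y 1 - pderiv 1 P y * y 0] := by
  filter_upwards [hP.eventually (by simp)] with y hy
  exact curl_smul_id (hy.differentiableAt (by norm_num))

lemma ContDiffAt.curl_smul_id {m n : WithTop ℕ∞} {P : E3 → ℝ} {x : E3} (hP : ContDiffAt ℝ n P x)
    (hmn : m + 1 ≤ n) : ContDiffAt ℝ m (_root_.curl fun y => P y • y) x :=
  ContDiffAt.curl (hP.smul contDiffAt_id) hmn

/-- The curl of a gradient vanishes. -/
lemma curl_gradient {f : E3 → ℝ} {x : E3} (hf : ContDiffAt ℝ 2 f x) :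
    curl (fun y => !₂[pderiv 0 f y, pderiv 1 f y, pderiv 2 f y]) x = 0 := by
  have hp := fun i => hf.pderiv (m := 1) (by norm_num) i
  have h := (contDiffAt_euclidean_three (hp 0) (hp 1) (hp 2)).differentiableAt (by norm_num)
  ext i
  fin_cases i <;> simp [curl, pderivComp_eq h, ← pderiv_comm hf]

/-- `∇ × ∇ × (𝐫 P) = ∇(P + 𝐫 · ∇P) - 𝐫 ∇²P`. -/
lemma curl_curl_smul_id {P : E3 → ℝ} {x : E3} (hP : ContDiffAt ℝ 2 P x) :
    curl (curl fun y => P y • y) x =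
      (fun f : E3 → ℝ => (!₂[pderiv 0 f x, pderiv 1 f x, pderiv 2 f x] : E3))
        (fun y => P y + (pderiv 0 P y * y 0 + pderiv 1 P y * y 1 + pderiv 2 P y * y 2))
      - Laplacian.laplacian P x • x := by
  have h1 : ContDiffAt ℝ 1 P x := hP.of_le (by norm_num)
  rw [(eventually_curl_smul_id h1).curl, laplacian_eq_sum_pderiv hP, Fin.sum_univ_three]
  have hp := fun i => hP.pderiv (m := 1) (by norm_num) i
  have hc : ∀ j : Fin 3, ContDiffAt ℝ 1 (fun y : E3 => y j) x := fun j => by fun_prop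
  have h := (contDiffAt_euclidean_three (((hp 1).mul (hc 2)).sub ((hp 2).mul (hc 1)))
    (((hp 2).mul (hc 0)).sub ((hp 0).mul (hc 2)))
    (((hp 0).mul (hc 1)).sub ((hp 1).mul (hc 0)))).differentiableAt (by norm_num)
  have hP' : DifferentiableAt ℝ P x := h1.differentiableAt (by norm_num)
  have hp' : ∀ i, DifferentiableAt ℝ (pderiv i P) x := fun i => (hp i).differentiableAt (by norm_num)
  have hm : ∀ i j, DifferentiableAt ℝ (fun y : E3 => pderiv i P y * y j) x :=
    fun i j => ((hp i).mul (hc j)).differentiableAt (by norm_num)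
  ext i
  fin_cases i <;>
    simp [curl, pderivComp_eq h, pderiv_sub, pderiv_add, hm, hp', hP', pderiv_mul_coord]
  · linear_combination x 1 * pderiv_comm hP 1 0 + x 2 * pderiv_comm hP 2 0
  · linear_combination x 2 * pderiv_comm hP 2 1 + x 0 * pderiv_comm hP 0 1
  · linear_combination x 0 * pderiv_comm hP 0 2 + x 1 * pderiv_comm hP 1 2

lemma ContDiffAt.curl_curl_smul_id {P : E3 → ℝ} {x : E3} (hP : ContDiffAt ℝ 3 P x) :
    ContDiffAt ℝ 1 (_root_.curl (_root_.curl fun y => P y • y)) x :=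
  ContDiffAt.curl (hP.curl_smul_id (m := 2) (by norm_num)) (by norm_num)

/-- The toroidal scalar of the curl of a poloidal field: `∇ × ∇ × ∇ × (𝐫 P) = ∇ × (-𝐫 ∇²P)`. -/
lemma curl_curl_curl_smul_id {P T : E3 → ℝ} {x : E3} (hP : ContDiffAt ℝ 3 P x)
    (hT : DifferentiableAt ℝ T x)
    (hTP : T =ᶠ[nhds x] fun y => -Laplacian.laplacian P y) :
    curl (curl (curl fun y => P y • y)) x = curl (fun y => T y • y) x := by
  set ψ : E3 → ℝ :=
    fun y => P y + (pderiv 0 P y * y 0 + pderiv 1 P y * y 1 + pderiv 2 P y * y 2)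
  have hp := fun i => hP.pderiv (m := 2) (by norm_num) i
  have hc : ∀ j : Fin 3, ContDiffAt ℝ 2 (fun y : E3 => y j) x := fun j => by fun_prop
  have hψ2 : ContDiffAt ℝ 2 ψ x :=
    (hP.of_le (by norm_num)).add
      ((((hp 0).mul (hc 0)).add ((hp 1).mul (hc 1))).add ((hp 2).mul (hc 2)))
  have hgrad := fun i => hψ2.pderiv (m := 1) (by norm_num) i
  have hev : (curl (curl fun y => P y • y)) =ᶠ[nhds x]
      fun y => (!₂[pderiv 0 ψ y, pderiv 1 ψ y, pderiv 2 ψ y] : E3) + T y • y := by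
    filter_upwards [hP.eventually (by simp), hTP] with y hy hTy
    rw [curl_curl_smul_id (hy.of_le (by norm_num)), hTy, neg_smul, ← sub_eq_add_neg]
  have hTx : DifferentiableAt ℝ (fun y => T y • y) x := hT.smul differentiableAt_id
  rw [hev.curl, curl_add
    ((contDiffAt_euclidean_three (hgrad 0) (hgrad 1) (hgrad 2)).differentiableAt (by norm_num))
    hTx, curl_gradient hψ2, zero_add]

/-! ### Potentials on the closed unit ball -/

lemma uniqueDiffOn_closedBall : UniqueDiffOn ℝ (Metric.closedBall (0 : E3) 1) :=
  uniqueDiffOn_convex (convex_closedBall 0 1)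
    ⟨0, Metric.ball_subset_interior_closedBall (Metric.mem_ball_self one_pos)⟩

lemma closedBall_mem_nhds {x : E3} (hx : x ∈ Metric.ball (0 : E3) 1) :
    Metric.closedBall (0 : E3) 1 ∈ nhds x :=
  Filter.mem_of_superset (Metric.isOpen_ball.mem_nhds hx) Metric.ball_subset_closedBall

lemma eq_sum_smul_single (h : E3) : h = ∑ i, h i • EuclideanSpace.single i (1 : ℝ) := by
  ext j
  simp [Finset.sum_apply, Pi.single_apply]

/-- The Jacobian of a curl-free field is symmetric. -/
lemma inner_fderiv_comm_of_curl_eq_zero {w : E3 → E3} {x : E3} (h : curl w x = 0) (a b : E3) :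
    inner ℝ (fderiv ℝ w x a) b = inner ℝ (fderiv ℝ w x b) a := by
  have h0 : pderivComp w 1 2 x - pderivComp w 2 1 x = 0 := congrArg (fun u : E3 => u 0) h
  have h1 : pderivComp w 2 0 x - pderivComp w 0 2 x = 0 := congrArg (fun u : E3 => u 1) h
  have h2 : pderivComp w 0 1 x - pderivComp w 1 0 x = 0 := congrArg (fun u : E3 => u 2) h
  have key : ∀ a b : E3, inner ℝ (fderiv ℝ w x a) b
      = ∑ j, ∑ i, a i * pderivComp w i j x * b j := by
    intro a b
    conv_lhs => rw [eq_sum_smul_single a]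
    simp only [map_add, map_smul, PiLp.inner_apply, RCLike.inner_apply, conj_trivial, pderivComp,
      PiLp.smul_apply, smul_eq_mul, Fin.sum_univ_three, PiLp.add_apply]
    ring
  rw [key, key]
  simp only [Fin.sum_univ_three]
  linear_combination (a 1 * b 2 - a 2 * b 1) * h0 + (a 2 * b 0 - a 0 * b 2) * h1
    + (a 0 * b 1 - a 1 * b 0) * h2

/-- The Poincaré lemma for a field of class `C¹` up to the boundary: a curl-free field on the unit
ball is the gradient of a function which is differentiable on the closed ball. -/
lemma exists_potential_of_curl_eq_zero {w : E3 → E3}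
    (hw : ContDiffOn ℝ 1 w (Metric.closedBall 0 1))
    (h : ∀ x ∈ Metric.ball (0 : E3) 1, curl w x = 0) :
    ∃ φ : E3 → ℝ, ∀ x ∈ Metric.closedBall (0 : E3) 1,
      HasFDerivWithinAt φ (innerSL ℝ (w x)) (Metric.closedBall 0 1) x := by
  have hd : ∀ x ∈ Metric.closedBall (0 : E3) 1, HasFDerivWithinAt (fun y => innerSL ℝ (w y))
      ((innerSL ℝ : E3 →L[ℝ] E3 →L[ℝ] ℝ).comp (fderivWithin ℝ w (Metric.closedBall 0 1) x))
      (Metric.closedBall 0 1) x := fun x hx =>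
    (innerSL ℝ : E3 →L[ℝ] E3 →L[ℝ] ℝ).hasFDerivAt.comp_hasFDerivWithinAt x
      ((hw.differentiableOn (by norm_num)) x hx).hasFDerivWithinAt
  refine (convex_closedBall (0 : E3) 1).exists_forall_hasFDerivWithinAt_of_hasFDerivWithinAt_symmetric
    hd fun x hx a _ b _ => ?_
  simp only [ContinuousLinearMap.comp_apply, innerSL_apply_apply]
  have hc := hw.continuousOn_fderivWithin uniqueDiffOn_closedBall (by norm_num)
  -- the symmetry of the Jacobian holds in the open ball and extends to the boundary by continuity
  have hcl : closure (Metric.ball (0 : E3) 1) = Metric.closedBall 0 1 :=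
    closure_ball 0 one_ne_zero
  have heq : Set.EqOn
      (fun y => inner ℝ (fderivWithin ℝ w (Metric.closedBall 0 1) y a) b)
      (fun y => inner ℝ (fderivWithin ℝ w (Metric.closedBall 0 1) y b) a)
      (Metric.ball (0 : E3) 1) := fun y hy => by
    simp only [fderivWithin_of_mem_nhds (closedBall_mem_nhds hy)]
    exact inner_fderiv_comm_of_curl_eq_zero (h y hy) a b
  exact heq.of_subset_closure
    ((hc.clm_apply continuousOn_const).inner continuousOn_const)
    ((hc.clm_apply continuousOn_const).inner continuousOn_const)
    Metric.ball_subset_closedBall hcl.ge hx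

/-- The partial derivative `∂ᵢ f` of a function on the closed unit ball, up to the boundary: the
derivative within the closed ball, which is unique because the ball is convex with interior. -/
def pderivClosed (i : Fin 3) (f : E3 → ℝ) (x : E3) : ℝ :=
  fderivWithin ℝ f (Metric.closedBall 0 1) x (EuclideanSpace.single i 1)

lemma pderivClosed_eq {f : E3 → ℝ} {x : E3} (hx : x ∈ Metric.ball (0 : E3) 1) (i : Fin 3) :
    pderivClosed i f x = pderiv i f x := by
  rw [pderivClosed, fderivWithin_of_mem_nhds (closedBall_mem_nhds hx), pderiv]

lemma ContDiffOn.pderivClosed {m n : WithTop ℕ∞} {f : E3 → ℝ}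
    (hf : ContDiffOn ℝ n f (Metric.closedBall 0 1)) (hmn : m + 1 ≤ n) (i : Fin 3) :
    ContDiffOn ℝ m (pderivClosed i f) (Metric.closedBall 0 1) :=
  (hf.fderivWithin uniqueDiffOn_closedBall hmn).clm_apply contDiffOn_const

/-- The toroidal field `∇P × 𝐫` on the closed unit ball, with the gradient taken up to the boundary.
-/
def gradCross (P : E3 → ℝ) (x : E3) : E3 :=
  !₂[pderivClosed 1 P x * x 2 - pderivClosed 2 P x * x 1,
     pderivClosed 2 P x * x 0 - pderivClosed 0 P x * x 2,
     pderivClosed 0 P x * x 1 - pderivClosed 1 P x * x 0]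

lemma ContDiffOn.gradCross {P : E3 → ℝ} (hP : ContDiffOn ℝ 2 P (Metric.closedBall 0 1)) :
    ContDiffOn ℝ 1 (gradCross P) (Metric.closedBall 0 1) := by
  have hp := fun i => hP.pderivClosed (m := 1) (by norm_num) i
  have hc : ∀ j : Fin 3, ContDiffOn ℝ 1 (fun y : E3 => y j) (Metric.closedBall 0 1) :=
    fun j => by fun_prop
  rw [contDiffOn_euclidean]
  intro i
  fin_cases i
  · exact ((hp 1).mul (hc 2)).sub ((hp 2).mul (hc 1))
  · exact ((hp 2).mul (hc 0)).sub ((hp 0).mul (hc 2))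
  · exact ((hp 0).mul (hc 1)).sub ((hp 1).mul (hc 0))

lemma ContDiffOn.contDiffAt_of_mem_ball {F : Type*} [NormedAddCommGroup F] [NormedSpace ℝ F]
    {n : WithTop ℕ∞} {f : E3 → F} (hf : ContDiffOn ℝ n f (Metric.closedBall 0 1)) {x : E3}
    (hx : x ∈ Metric.ball (0 : E3) 1) : ContDiffAt ℝ n f x :=
  hf.contDiffAt (closedBall_mem_nhds hx)

/-- If `(P, T)` are scalars of `∇ × v`, then `v = ∇φ + ∇P × 𝐫 + 𝐫 T` up to the boundary, since
`v - ∇P × 𝐫 - 𝐫 T` is curl-free. -/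
lemma IsPTScalars.exists_potential {v : E3 → E3} {P T : E3 → ℝ}
    (hv : ContDiffOn ℝ 1 v (Metric.closedBall 0 1)) (h : IsPTScalars (curl v) P T) :
    ∃ φ : E3 → ℝ, ∀ x ∈ Metric.closedBall (0 : E3) 1,
      HasFDerivWithinAt φ (innerSL ℝ (v x - gradCross P x - T x • x)) (Metric.closedBall 0 1) x := by
  refine exists_potential_of_curl_eq_zero (w := fun x => v x - gradCross P x - T x • x)
    ((hv.sub h.contDiffOn_poloidal.gradCross).sub (h.contDiffOn_toroidal.smul contDiffOn_id)) ?_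
  intro x hx
  have hP := h.contDiffOn_poloidal.contDiffAt_of_mem_ball hx
  have hT := h.contDiffOn_toroidal.contDiffAt_of_mem_ball hx
  have hv' := hv.contDiffAt_of_mem_ball hx
  have hTx : DifferentiableAt ℝ (fun y => T y • y) x :=
    (hT.differentiableAt (by norm_num)).smul differentiableAt_id
  have hU : DifferentiableAt ℝ (curl fun y => P y • y) x :=
    (hP.curl_smul_id (m := 1) (by norm_num)).differentiableAt (by norm_num)
  have hvd : DifferentiableAt ℝ v x := hv'.differentiableAt (by norm_num)
  have hev : (fun x => v x - gradCross P x - T x • x) =ᶠ[nhds x]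
      fun x => v x - curl (fun y => P y • y) x - T x • x := by
    filter_upwards [Metric.isOpen_ball.mem_nhds hx] with y hy
    rw [curl_smul_id ((h.contDiffOn_poloidal.contDiffAt_of_mem_ball hy).differentiableAt
      (by norm_num)), gradCross]
    simp only [pderivClosed_eq hy]
  rw [hev.curl, curl_sub (hvd.fun_sub hU) hTx, curl_sub hvd hU, h.eq_add x hx]
  abel

/-! ### Tangential derivatives on spheres -/

lemma smul_coe_mem_closedBall {ρ : ℝ} (hρ : ρ ∈ Set.Icc (0 : ℝ) 1) (ξ : S2) :
    ρ • (ξ : E3) ∈ Metric.closedBall (0 : E3) 1 := by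
  rw [mem_closedBall_zero_iff, norm_smul, mem_sphere_zero_iff_norm.1 ξ.2, mul_one, Real.norm_eq_abs,
    abs_of_nonneg hρ.1]
  exact hρ.2

lemma ContinuousOn.comp_smul_sphere {u : E3 → ℝ} (hu : ContinuousOn u (Metric.closedBall 0 1))
    {ρ : ℝ} (hρ : ρ ∈ Set.Icc (0 : ℝ) 1) : Continuous fun ξ : S2 => u (ρ • (ξ : E3)) :=
  hu.comp_continuous (by fun_prop) (smul_coe_mem_closedBall hρ)

lemma hasDerivAt_of_forall_coord {c : ℝ → E3} {c' : E3} {t : ℝ}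
    (h : ∀ i, HasDerivAt (fun s => c s i) (c' i) t) : HasDerivAt c c' t := by
  rw [← hasDerivWithinAt_univ, hasDerivWithinAt_iff_hasFDerivWithinAt, hasFDerivWithinAt_euclidean]
  intro i
  refine ((h i).hasDerivWithinAt (s := Set.univ)).hasFDerivWithinAt.congr_fderiv ?_
  ext
  simp

lemma hasDerivAt_spherePoint_azimuth (lam θ : ℝ) :
    HasDerivAt (fun s => (spherePoint s θ : E3)) (Real.sin θ • azimuthHat lam) lam := by
  refine hasDerivAt_of_forall_coord fun i => ?_
  fin_cases i
  · simpa [spherePoint, azimuthHat] using (Real.hasDerivAt_cos lam).const_mul (Real.sin θ)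
  · simpa [spherePoint, azimuthHat] using (Real.hasDerivAt_sin lam).const_mul (Real.sin θ)
  · simpa [spherePoint, azimuthHat] using hasDerivAt_const lam (Real.cos θ)

lemma hasDerivAt_spherePoint_polar (lam θ : ℝ) :
    HasDerivAt (fun s => (spherePoint lam s : E3)) (polarHat lam θ) θ := by
  refine hasDerivAt_of_forall_coord fun i => ?_
  fin_cases i
  · simpa [spherePoint, polarHat] using (Real.hasDerivAt_sin θ).mul_const (Real.cos lam)
  · simpa [spherePoint, polarHat] using (Real.hasDerivAt_sin θ).mul_const (Real.sin lam)
  · simpa [spherePoint, polarHat] using Real.hasDerivAt_cos θ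

lemma dAzimuth_comp_smul {u : E3 → ℝ} {L : E3 →L[ℝ] ℝ} {ρ lam θ : ℝ}
    (hρ : ρ ∈ Set.Icc (0 : ℝ) 1)
    (hu : HasFDerivWithinAt u L (Metric.closedBall 0 1) (ρ • (spherePoint lam θ : E3))) :
    dAzimuth (fun ξ => u (ρ • (ξ : E3))) lam θ = ρ * (Real.sin θ * L (azimuthHat lam)) := by
  have h := HasFDerivWithinAt.comp_hasDerivAt (f := fun s => ρ • (spherePoint s θ : E3)) lam hu
    ((hasDerivAt_spherePoint_azimuth lam θ).const_smul ρ)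
    (Filter.Eventually.of_forall fun s => smul_coe_mem_closedBall hρ _)
  rw [map_smul, map_smul, smul_eq_mul, smul_eq_mul] at h
  exact h.deriv

lemma dPolar_comp_smul {u : E3 → ℝ} {L : E3 →L[ℝ] ℝ} {ρ lam θ : ℝ}
    (hρ : ρ ∈ Set.Icc (0 : ℝ) 1)
    (hu : HasFDerivWithinAt u L (Metric.closedBall 0 1) (ρ • (spherePoint lam θ : E3))) :
    dPolar (fun ξ => u (ρ • (ξ : E3))) lam θ = ρ * L (polarHat lam θ) := by
  have h := HasFDerivWithinAt.comp_hasDerivAt (f := fun s => ρ • (spherePoint lam s : E3)) θ hu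
    ((hasDerivAt_spherePoint_polar lam θ).const_smul ρ)
    (Filter.Eventually.of_forall fun s => smul_coe_mem_closedBall hρ _)
  rw [map_smul, smul_eq_mul] at h
  exact h.deriv

lemma differentiable_comp_smul_spherePoint {u : E3 → ℝ}
    (hu : DifferentiableOn ℝ u (Metric.closedBall 0 1)) {ρ : ℝ} (hρ : ρ ∈ Set.Icc (0 : ℝ) 1) :
    Differentiable ℝ fun p : ℝ × ℝ => u (ρ • (spherePoint p.1 p.2 : E3)) := by
  have hs : Differentiable ℝ fun p : ℝ × ℝ => ρ • (spherePoint p.1 p.2 : E3) :=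
    ((contDiff_spherePoint (n := 1)).differentiable (by norm_num)).const_smul ρ
  intro p
  exact ((hu _ (smul_coe_mem_closedBall hρ _)).hasFDerivWithinAt.comp_hasFDerivAt p
    (hs p).hasFDerivAt
    (Filter.Eventually.of_forall fun q => smul_coe_mem_closedBall hρ _)).differentiableAt

lemma ContMDiff.differentiable_spherePoint {f : S2 → ℝ} (hf : ContMDiff (𝓡 2) 𝓘(ℝ, ℝ) 2 f) :
    Differentiable ℝ fun p : ℝ × ℝ => f (spherePoint p.1 p.2) := by
  have hs : ContMDiff 𝓘(ℝ, ℝ × ℝ) (𝓡 2) 2 fun p : ℝ × ℝ => spherePoint p.1 p.2 :=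
    (contDiff_spherePoint (n := 2)).contMDiff.codRestrict_sphere _
  exact (hf.comp hs).contDiff.differentiable (by norm_num)

lemma dAzimuth_sub {f g : S2 → ℝ} (hf : Differentiable ℝ fun p : ℝ × ℝ => f (spherePoint p.1 p.2))
    (hg : Differentiable ℝ fun p : ℝ × ℝ => g (spherePoint p.1 p.2)) (lam θ : ℝ) :
    dAzimuth (fun ξ => f ξ - g ξ) lam θ = dAzimuth f lam θ - dAzimuth g lam θ := by
  have hp : DifferentiableAt ℝ (fun s : ℝ => (s, θ)) lam := by fun_prop
  have h1 : DifferentiableAt ℝ (fun s => f (spherePoint s θ)) lam :=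
    (hf (lam, θ)).comp (f := fun s : ℝ => (s, θ)) lam hp
  have h2 : DifferentiableAt ℝ (fun s => g (spherePoint s θ)) lam :=
    (hg (lam, θ)).comp (f := fun s : ℝ => (s, θ)) lam hp
  exact deriv_fun_sub h1 h2

lemma dPolar_sub {f g : S2 → ℝ} (hf : Differentiable ℝ fun p : ℝ × ℝ => f (spherePoint p.1 p.2))
    (hg : Differentiable ℝ fun p : ℝ × ℝ => g (spherePoint p.1 p.2)) (lam θ : ℝ) :
    dPolar (fun ξ => f ξ - g ξ) lam θ = dPolar f lam θ - dPolar g lam θ := by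
  have hp : DifferentiableAt ℝ (fun s : ℝ => (lam, s)) θ := by fun_prop
  have h1 : DifferentiableAt ℝ (fun s => f (spherePoint lam s)) θ :=
    (hf (lam, θ)).comp (f := fun s : ℝ => (lam, s)) θ hp
  have h2 : DifferentiableAt ℝ (fun s => g (spherePoint lam s)) θ :=
    (hg (lam, θ)).comp (f := fun s : ℝ => (lam, s)) θ hp
  exact deriv_fun_sub h1 h2

lemma inner_eq_sum_three (a b : E3) : inner ℝ a b = a 0 * b 0 + a 1 * b 1 + a 2 * b 2 := by
  simp only [PiLp.inner_apply, RCLike.inner_apply, conj_trivial, Fin.sum_univ_three]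
  ring

lemma fderivWithin_eq_sum (P : E3 → ℝ) (x h : E3) :
    fderivWithin ℝ P (Metric.closedBall 0 1) x h
      = pderivClosed 0 P x * h 0 + pderivClosed 1 P x * h 1 + pderivClosed 2 P x * h 2 := by
  conv_lhs => rw [eq_sum_smul_single h]
  simp only [map_add, map_smul, pderivClosed, Fin.sum_univ_three, smul_eq_mul]
  ring

/-- On the sphere of radius `ρ`, `λ̂ · (∇P × 𝐫 + 𝐫 T) = -ρ θ̂ · ∇P`. -/
lemma inner_azimuthHat (P : E3 → ℝ) (w : E3) (t ρ lam θ : ℝ) :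
    inner ℝ (w - gradCross P (ρ • (spherePoint lam θ : E3)) - t • ρ • (spherePoint lam θ : E3))
        (azimuthHat lam)
      = inner ℝ w (azimuthHat lam)
        + ρ * fderivWithin ℝ P (Metric.closedBall 0 1) (ρ • (spherePoint lam θ : E3))
          (polarHat lam θ) := by
  rw [fderivWithin_eq_sum, inner_eq_sum_three, inner_eq_sum_three]
  set G := fun i => pderivClosed i P (ρ • (spherePoint lam θ : E3))
  have h0 : pderivClosed 0 P (ρ • (spherePoint lam θ : E3)) = G 0 := rfl
  have h1 : pderivClosed 1 P (ρ • (spherePoint lam θ : E3)) = G 1 := rfl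
  have h2 : pderivClosed 2 P (ρ • (spherePoint lam θ : E3)) = G 2 := rfl
  rw [gradCross, h0, h1, h2]
  clear_value G
  simp [spherePoint, azimuthHat, polarHat]
  linear_combination (-(ρ * Real.sin θ * G 2)) * Real.sin_sq_add_cos_sq lam

/-- On the sphere of radius `ρ`, `θ̂ · (∇P × 𝐫 + 𝐫 T) = ρ λ̂ · ∇P`. -/
lemma inner_polarHat (P : E3 → ℝ) (w : E3) (t ρ lam θ : ℝ) :
    inner ℝ (w - gradCross P (ρ • (spherePoint lam θ : E3)) - t • ρ • (spherePoint lam θ : E3))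
        (polarHat lam θ)
      = inner ℝ w (polarHat lam θ)
        - ρ * fderivWithin ℝ P (Metric.closedBall 0 1) (ρ • (spherePoint lam θ : E3))
          (azimuthHat lam) := by
  rw [fderivWithin_eq_sum, inner_eq_sum_three, inner_eq_sum_three]
  set G := fun i => pderivClosed i P (ρ • (spherePoint lam θ : E3))
  have h0 : pderivClosed 0 P (ρ • (spherePoint lam θ : E3)) = G 0 := rfl
  have h1 : pderivClosed 1 P (ρ • (spherePoint lam θ : E3)) = G 1 := rfl
  have h2 : pderivClosed 2 P (ρ • (spherePoint lam θ : E3)) = G 2 := rfl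
  rw [gradCross, h0, h1, h2]
  clear_value G
  simp [spherePoint, azimuthHat, polarHat]
  have e1 := Real.sin_sq_add_cos_sq lam
  have e2 := Real.sin_sq_add_cos_sq θ
  linear_combination (ρ * (G 0 * Real.sin lam - G 1 * Real.cos lam)) * e2
    - t * ρ * Real.sin θ * Real.cos θ * e1

/-- The azimuthal component of `∇φ = v - ∇P × 𝐫 - 𝐫 T` on the sphere of radius `ρ`. -/
lemma dAzimuth_potential {v : E3 → E3} {P T φ : E3 → ℝ}
    (hP : DifferentiableOn ℝ P (Metric.closedBall 0 1))
    (hφ : ∀ x ∈ Metric.closedBall (0 : E3) 1,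
      HasFDerivWithinAt φ (innerSL ℝ (v x - gradCross P x - T x • x)) (Metric.closedBall 0 1) x)
    {ρ : ℝ} (hρ : ρ ∈ Set.Icc (0 : ℝ) 1) (lam θ : ℝ) :
    dAzimuth (fun ξ => φ (ρ • (ξ : E3))) lam θ
      = ρ * (Real.sin θ * (inner ℝ (v (ρ • (spherePoint lam θ : E3))) (azimuthHat lam)
        + dPolar (fun ξ => P (ρ • (ξ : E3))) lam θ)) := by
  have hx := smul_coe_mem_closedBall hρ (spherePoint lam θ)
  rw [dAzimuth_comp_smul hρ (hφ _ hx), dPolar_comp_smul hρ (hP _ hx).hasFDerivWithinAt,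
    innerSL_apply_apply, inner_azimuthHat]

/-- The polar component of `∇φ = v - ∇P × 𝐫 - 𝐫 T` on the sphere of radius `ρ`. -/
lemma dPolar_potential {v : E3 → E3} {P T φ : E3 → ℝ}
    (hP : DifferentiableOn ℝ P (Metric.closedBall 0 1))
    (hφ : ∀ x ∈ Metric.closedBall (0 : E3) 1,
      HasFDerivWithinAt φ (innerSL ℝ (v x - gradCross P x - T x • x)) (Metric.closedBall 0 1) x)
    {ρ : ℝ} (hρ : ρ ∈ Set.Icc (0 : ℝ) 1) (lam θ : ℝ) :
    Real.sin θ * dPolar (fun ξ => φ (ρ • (ξ : E3))) lam θ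
      = ρ * (Real.sin θ * inner ℝ (v (ρ • (spherePoint lam θ : E3))) (polarHat lam θ)
        - dAzimuth (fun ξ => P (ρ • (ξ : E3))) lam θ) := by
  have hx := smul_coe_mem_closedBall hρ (spherePoint lam θ)
  rw [dPolar_comp_smul hρ (hφ _ hx), dAzimuth_comp_smul hρ (hP _ hx).hasFDerivWithinAt,
    innerSL_apply_apply, inner_polarHat]
  ring

/-! ### Poloidal scalars on spheres -/

/-- The boundary values of the poloidal scalar of the vorticity: on the unit sphere
`∇₁ (f - φ) = Λ₁ (P - g)`. -/
theorem IsPTScalars.exists_sub_eq_const_of_boundary {v : E3 → E3} {f g : S2 → ℝ} {P T : E3 → ℝ}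
    (hv : ContDiffOn ℝ 1 v (Metric.closedBall 0 1))
    (hf : ContMDiff (𝓡 2) 𝓘(ℝ, ℝ) 2 f) (hg : ContMDiff (𝓡 2) 𝓘(ℝ, ℝ) 2 g)
    (hbdry : ∀ lam θ : ℝ, θ ∈ Set.Ioo 0 Real.pi →
      v (spherePoint lam θ) = surfaceGrad f lam θ + surfaceCurl g lam θ)
    (h : IsPTScalars (curl v) P T) : ∃ c, ∀ ξ : S2, P ξ - g ξ = c := by
  obtain ⟨φ, hφ⟩ := h.exists_potential hv
  have h1 : (1 : ℝ) ∈ Set.Icc (0 : ℝ) 1 := by simp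
  have hPd : DifferentiableOn ℝ P (Metric.closedBall 0 1) :=
    h.contDiffOn_poloidal.differentiableOn (by norm_num)
  have hφd : DifferentiableOn ℝ φ (Metric.closedBall 0 1) :=
    fun x hx => (hφ x hx).differentiableWithinAt
  have hP' := differentiable_comp_smul_spherePoint hPd h1
  have hφ' := differentiable_comp_smul_spherePoint hφd h1
  have hPc := hPd.continuousOn.comp_smul_sphere h1
  have hφc := hφd.continuousOn.comp_smul_sphere h1
  have eA := dAzimuth_potential hPd hφ h1
  have eP := dPolar_potential hPd hφ h1
  simp only [one_smul, one_mul] at hP' hφ' hPc hφc eA eP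
  have hf' := hf.differentiable_spherePoint
  have hg' := hg.differentiable_spherePoint
  -- the components of the boundary values along the two coordinate unit vectors
  have hvA : ∀ lam, ∀ θ ∈ Set.Ioo 0 Real.pi,
      Real.sin θ * inner ℝ (v (spherePoint lam θ)) (azimuthHat lam)
        = dAzimuth f lam θ - Real.sin θ * dPolar g lam θ := by
    intro lam θ hθ
    have hs := (Real.sin_pos_of_mem_Ioo hθ).ne'
    rw [hbdry lam θ hθ, inner_eq_sum_three]
    simp [surfaceGrad, surfaceCurl, azimuthHat, polarHat]
    field_simp
    linear_combination (dAzimuth f lam θ - Real.sin θ * dPolar g lam θ)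
      * Real.sin_sq_add_cos_sq lam
  have hvP : ∀ lam, ∀ θ ∈ Set.Ioo 0 Real.pi,
      Real.sin θ * inner ℝ (v (spherePoint lam θ)) (polarHat lam θ)
        = Real.sin θ * dPolar f lam θ + dAzimuth g lam θ := by
    intro lam θ hθ
    have hs := (Real.sin_pos_of_mem_Ioo hθ).ne'
    rw [hbdry lam θ hθ, inner_eq_sum_three]
    simp [surfaceGrad, surfaceCurl, azimuthHat, polarHat]
    field_simp
    linear_combination (Real.sin θ * dPolar f lam θ + dAzimuth g lam θ) *
      (Real.cos θ ^ 2 * Real.sin_sq_add_cos_sq lam + Real.sin_sq_add_cos_sq θ)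
  refine exists_const_of_cauchyRiemann (a := fun ξ => f ξ - φ ξ) (b := fun ξ => P ξ - g ξ)
    (hf.continuous.sub hφc) (hPc.sub hg.continuous) (hf'.sub hφ') (hP'.sub hg') ?_ ?_
  · intro lam θ hθ
    rw [dAzimuth_sub hf' hφ', dPolar_sub hP' hg', eA, mul_add, hvA lam θ hθ]
    ring
  · intro lam θ hθ
    rw [dAzimuth_sub hP' hg', dPolar_sub hf' hφ', mul_sub, eP, hvP lam θ hθ]
    ring

/-- Poloidal scalars of the zero field are constant on every sphere about the origin. -/
theorem IsPTScalars.exists_eq_const_of_zero {Q S : E3 → ℝ} (h : IsPTScalars (fun _ => 0) Q S)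
    {ρ : ℝ} (hρ : ρ ∈ Set.Icc (0 : ℝ) 1) : ∃ c, ∀ ξ : S2, Q (ρ • (ξ : E3)) = c := by
  rcases hρ.1.eq_or_lt with rfl | hpos
  · exact ⟨Q 0, fun ξ => by rw [zero_smul]⟩
  rw [← curl_zero] at h
  obtain ⟨φ, hφ⟩ := h.exists_potential (v := fun _ => 0) contDiffOn_const
  have hQd : DifferentiableOn ℝ Q (Metric.closedBall 0 1) :=
    h.contDiffOn_poloidal.differentiableOn (by norm_num)
  have hφd : DifferentiableOn ℝ φ (Metric.closedBall 0 1) :=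
    fun x hx => (hφ x hx).differentiableWithinAt
  have hQ' := differentiable_comp_smul_spherePoint hQd hρ
  have hφ' := differentiable_comp_smul_spherePoint hφd hρ
  -- `∇₁ φ = -ρ Λ₁ Q` on the sphere of radius `ρ`
  obtain ⟨c, hc⟩ := exists_const_of_cauchyRiemann (a := fun ξ => -ρ⁻¹ * φ (ρ • (ξ : E3)))
    (b := fun ξ => Q (ρ • (ξ : E3))) ((hφd.continuousOn.comp_smul_sphere hρ).const_mul _)
    (hQd.continuousOn.comp_smul_sphere hρ) (hφ'.const_mul _) hQ'
    (fun lam θ _ => by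
      have e := dAzimuth_potential hQd hφ hρ lam θ
      rw [inner_zero_left, zero_add] at e
      have e' : dAzimuth (fun ξ => -ρ⁻¹ * φ (ρ • (ξ : E3))) lam θ
          = -ρ⁻¹ * dAzimuth (fun ξ => φ (ρ • (ξ : E3))) lam θ := deriv_const_mul_field _
      rw [e', e]
      field_simp)
    (fun lam θ _ => by
      have e := dPolar_potential hQd hφ hρ lam θ
      rw [inner_zero_left, mul_zero, zero_sub] at e
      have e' : dPolar (fun ξ => -ρ⁻¹ * φ (ρ • (ξ : E3))) lam θ
          = -ρ⁻¹ * dPolar (fun ξ => φ (ρ • (ξ : E3))) lam θ := deriv_const_mul_field _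
      rw [e', mul_left_comm, e]
      field_simp)
  exact ⟨c, hc⟩

/-! ### Operations on poloidal and toroidal scalars -/

/-- The difference of two pairs of scalars of one field is a pair of scalars of the zero field. -/
lemma IsPTScalars.sub {u : E3 → E3} {P T P' T' : E3 → ℝ} (h : IsPTScalars u P T)
    (h' : IsPTScalars u P' T') :
    IsPTScalars (fun _ => 0) (fun x => P x - P' x) (fun x => T x - T' x) := by
  refine ⟨h.contDiffOn_poloidal.sub h'.contDiffOn_poloidal,
    h.contDiffOn_toroidal.sub h'.contDiffOn_toroidal, fun x hx => ?_⟩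
  have hd : ∀ {A : E3 → ℝ} {y : E3}, ContDiffAt ℝ 1 A y →
      DifferentiableAt ℝ (fun y => A y • y) y := fun hA =>
    (hA.differentiableAt (by norm_num)).smul differentiableAt_id
  have hP := h.contDiffOn_poloidal.contDiffAt_of_mem_ball hx
  have hP' := h'.contDiffOn_poloidal.contDiffAt_of_mem_ball hx
  have hT := h.contDiffOn_toroidal.contDiffAt_of_mem_ball hx
  have hT' := h'.contDiffOn_toroidal.contDiffAt_of_mem_ball hx
  have hev : curl (fun y => (P y - P' y) • y) =ᶠ[nhds x]
      fun z => curl (fun y => P y • y) z - curl (fun y => P' y • y) z := by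
    filter_upwards [hP.eventually (by simp), hP'.eventually (by simp)] with y hy hy'
    simp only [sub_smul]
    exact curl_sub (hd (hy.of_le (by norm_num))) (hd (hy'.of_le (by norm_num)))
  rw [hev.curl, curl_sub ((hP.curl_smul_id (m := 1) (by norm_num)).differentiableAt (by norm_num))
    ((hP'.curl_smul_id (m := 1) (by norm_num)).differentiableAt (by norm_num))]
  simp only [sub_smul]
  rw [curl_sub (hd hT) (hd hT')]
  have e := (h.eq_add x hx).symm.trans (h'.eq_add x hx)
  rw [sub_add_sub_comm, e, sub_self]

/-- Additive constants are free in the poloidal scalar, since `∇ × 𝐫 = 0`. -/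
lemma IsPTScalars.sub_const {u : E3 → E3} {P T : E3 → ℝ} (h : IsPTScalars u P T) (c : ℝ) :
    IsPTScalars u (fun x => P x - c) T := by
  refine ⟨h.contDiffOn_poloidal.sub contDiffOn_const, h.contDiffOn_toroidal, fun x hx => ?_⟩
  have hev : curl (fun y => (P y - c) • y) =ᶠ[nhds x] curl fun y => P y • y := by
    filter_upwards [Metric.isOpen_ball.mem_nhds hx] with y hy
    have hP : DifferentiableAt ℝ P y :=
      (h.contDiffOn_poloidal.contDiffAt_of_mem_ball hy).differentiableAt (by norm_num)
    rw [curl_smul_id hP, curl_smul_id (hP.sub_const c)]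
    simp [pderiv, fderiv_sub_const]
  rw [h.eq_add x hx, hev.curl]

/-- The curl swaps the two kinds of scalars: the toroidal scalar of `v` is a poloidal scalar of the
vorticity, and its toroidal partner `-∇²P` extends continuously differentiably to the boundary. -/
theorem IsPTScalars.curl {v : E3 → E3} {P T : E3 → ℝ}
    (hP : ContDiffOn ℝ 3 P (Metric.closedBall 0 1)) (hT : ContDiffOn ℝ 2 T (Metric.closedBall 0 1))
    (h : IsPTScalars v P T) :
    ∃ S : E3 → ℝ, (∀ x ∈ Metric.ball (0 : E3) 1, S x = -Laplacian.laplacian P x) ∧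
      IsPTScalars (_root_.curl v) T S := by
  have hp : ContDiffOn ℝ 1 (fun x => -∑ i, pderivClosed i (pderivClosed i P) x)
      (Metric.closedBall 0 1) :=
    (ContDiffOn.sum fun i _ => (hP.pderivClosed (m := 2) (by norm_num) i).pderivClosed
      (m := 1) (by norm_num) i).neg
  have hlap : ∀ x ∈ Metric.ball (0 : E3) 1,
      -∑ i, pderivClosed i (pderivClosed i P) x = -Laplacian.laplacian P x := by
    intro x hx
    rw [laplacian_eq_sum_pderiv ((hP.contDiffAt_of_mem_ball hx).of_le (by norm_num))]
    congr 1
    refine Finset.sum_congr rfl fun i _ => ?_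
    rw [pderivClosed_eq hx]
    refine Filter.EventuallyEq.pderiv ?_ i
    filter_upwards [Metric.isOpen_ball.mem_nhds hx] with y hy
    exact pderivClosed_eq hy i
  refine ⟨_, hlap, hT, hp, fun x hx => ?_⟩
  have hev : v =ᶠ[nhds x] fun x =>
      _root_.curl (_root_.curl fun y => P y • y) x + _root_.curl (fun y => T y • y) x := by
    filter_upwards [Metric.isOpen_ball.mem_nhds hx] with y hy using h.eq_add y hy
  have hPx := hP.contDiffAt_of_mem_ball hx
  have hTx := hT.contDiffAt_of_mem_ball hx
  have hSx := hp.contDiffAt_of_mem_ball hx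
  have hS : (fun x => -∑ i, pderivClosed i (pderivClosed i P) x) =ᶠ[nhds x]
      fun y => -Laplacian.laplacian P y := by
    filter_upwards [Metric.isOpen_ball.mem_nhds hx] with y hy using hlap y hy
  rw [hev.curl, curl_add
    ((hPx.curl_curl_smul_id).differentiableAt (by norm_num))
    ((hTx.curl_smul_id (m := 1) (by norm_num)).differentiableAt (by norm_num)),
    curl_curl_curl_smul_id hPx (hSx.differentiableAt (by norm_num)) hS, add_comm]

/-! ### Spherical means -/

lemma sphereMean_add_const {u : S2 → ℝ} (hu : Continuous u) (c : ℝ) :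
    sphereMean (fun ξ => u ξ + c) = sphereMean u + c := by
  have hi : MeasureTheory.Integrable u
      (MeasureTheory.volume : MeasureTheory.Measure E3).toSphere :=
    hu.integrable_of_hasCompactSupport (HasCompactSupport.of_compactSpace u)
  have : NeZero (MeasureTheory.volume : MeasureTheory.Measure E3).toSphere := by
    refine ⟨fun h0 => ?_⟩
    have := isOpen_univ.measure_ne_zero (MeasureTheory.volume : MeasureTheory.Measure E3).toSphere
      ⟨spherePoint 0 0, trivial⟩
    simp [h0] at this
  rw [sphereMean, MeasureTheory.average, MeasureTheory.integral_add (hi.to_average)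
    (MeasureTheory.integrable_const c)]
  rw [MeasureTheory.integral_const, MeasureTheory.probReal_univ, one_smul]
  rfl

lemma eq_of_sub_eq_const_of_sphereMean_eq {u w : S2 → ℝ} (hw : Continuous w) {c : ℝ}
    (h : ∀ ξ, u ξ - w ξ = c) (hm : sphereMean u = sphereMean w) (ξ : S2) : u ξ = w ξ := by
  have hu : u = fun ξ => w ξ + c := funext fun ξ => by linarith [h ξ]
  rw [hu, sphereMean_add_const hw] at hm
  linarith [h ξ]

lemma exists_eq_norm_smul (x : E3) : ∃ ξ : S2, x = ‖x‖ • (ξ : E3) := by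
  rcases eq_or_ne x 0 with rfl | hx
  · exact ⟨spherePoint 0 0, by simp⟩
  · have hn := norm_ne_zero_iff.2 hx
    exact ⟨⟨‖x‖⁻¹ • x, by simp [norm_smul, hn]⟩, by simp [smul_smul, hn]⟩

end

theorem mainTheorem2 (v : E3 → E3) (f g : S2 → ℝ)
    (hv : ContDiffOn ℝ 1 v (Metric.closedBall 0 1))
    (hf : ContMDiff (𝓡 2) 𝓘(ℝ, ℝ) 2 f)
    (hg : ContMDiff (𝓡 2) 𝓘(ℝ, ℝ) 2 g)
    -- `v|_{∂Ω} = ∇₁ f + Λ₁ g`, away from the two poles, where the coordinates are singular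
    (hbdry : ∀ lam θ : ℝ, θ ∈ Set.Ioo 0 Real.pi →
      v (spherePoint lam θ) = surfaceGrad f lam θ + surfaceCurl g lam θ) :
    -- the poloidal scalars of the vorticity
    (∀ Pω Tω : E3 → ℝ, IsPTScalars (curl v) Pω Tω →
      -- `P_ω|_{∂Ω} = g`, up to the additive constant that is free in `P_ω`
      (∃ c : ℝ, IsPTScalars (curl v) (fun x => Pω x - c) Tω ∧ ∀ ξ : S2, Pω ξ - c = g ξ) ∧
      -- `P_ω|_{∂Ω} = g`, once that constant has been fixed through the mean value
      (sphereMean (fun ξ => Pω ξ) = sphereMean g → ∀ ξ : S2, Pω ξ = g ξ)) ∧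
    -- the toroidal scalars of the velocity
    (∀ Pv Tv : E3 → ℝ, ContDiffOn ℝ 3 Pv (Metric.closedBall 0 1) →
      ContDiffOn ℝ 2 Tv (Metric.closedBall 0 1) → IsPTScalars v Pv Tv →
      -- `T_v` is a poloidal scalar of the vorticity, with toroidal partner `-∇² P_v`
      (∃ T : E3 → ℝ, (∀ x ∈ Metric.ball (0 : E3) 1, T x = -Laplacian.laplacian Pv x) ∧
        IsPTScalars (curl v) Tv T) ∧
      -- `T_v = P_ω` for every `P_ω`, up to a function of the radius, and exactly once that
      -- function has been fixed through the mean values over the spheres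
      (∀ Pω Tω : E3 → ℝ, IsPTScalars (curl v) Pω Tω →
        (∃ h : ℝ → ℝ, ∀ x ∈ Metric.closedBall (0 : E3) 1, Tv x = Pω x + h ‖x‖) ∧
        ((∀ r ∈ Set.Icc (0 : ℝ) 1, sphereMean (fun ξ => Tv (r • (ξ : E3))) =
            sphereMean (fun ξ => Pω (r • (ξ : E3)))) →
          ∀ x ∈ Metric.closedBall (0 : E3) 1, Tv x = Pω x)) ∧
      -- `T_v(1, ·) = g`, in the same two senses
      (∃ c : ℝ, ∀ ξ : S2, Tv ξ - c = g ξ) ∧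
      (sphereMean (fun ξ => Tv ξ) = sphereMean g → ∀ ξ : S2, Tv ξ = g ξ)) := by
  refine ⟨fun Pω Tω hω => ?_, fun Pv Tv hPv hTv hPT => ?_⟩
  · obtain ⟨c, hc⟩ := hω.exists_sub_eq_const_of_boundary hv hf hg hbdry
    exact ⟨⟨c, hω.sub_const c, fun ξ => by linarith [hc ξ]⟩,
      fun hm => eq_of_sub_eq_const_of_sphereMean_eq hg.continuous hc hm⟩
  · obtain ⟨S, hS, hTS⟩ := hPT.curl hPv hTv
    refine ⟨⟨S, hS, hTS⟩, fun Pω Tω hω => ?_, ?_⟩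
    · have hconst : ∀ r ∈ Set.Icc (0 : ℝ) 1, ∃ c, ∀ ξ : S2,
          Tv (r • (ξ : E3)) - Pω (r • (ξ : E3)) = c :=
        fun r hr => (hTS.sub hω).exists_eq_const_of_zero hr
      choose! h hh using hconst
      refine ⟨⟨h, fun x hx => ?_⟩, fun hm x hx => ?_⟩
      · obtain ⟨ξ, hξ⟩ := exists_eq_norm_smul x
        have hr := hh ‖x‖ ⟨norm_nonneg x, mem_closedBall_zero_iff.1 hx⟩ ξ
        rw [← hξ] at hr
        linarith
      · obtain ⟨ξ, hξ⟩ := exists_eq_norm_smul x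
        have hx' : ‖x‖ ∈ Set.Icc (0 : ℝ) 1 := ⟨norm_nonneg x, mem_closedBall_zero_iff.1 hx⟩
        have he := eq_of_sub_eq_const_of_sphereMean_eq
          (hω.contDiffOn_poloidal.continuousOn.comp_smul_sphere hx') (hh _ hx') (hm _ hx') ξ
        rwa [← hξ] at he
    · obtain ⟨c, hc⟩ := hTS.exists_sub_eq_const_of_boundary hv hf hg hbdry
      exact ⟨⟨c, fun ξ => by linarith [hc ξ]⟩,
        fun hm => eq_of_sub_eq_const_of_sphereMean_eq hg.continuous hc hm⟩
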